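/- For $0<p\le\infty$ and a positive integer $n$, let $\ell_p^n$ be $\mathbb{R}^n$ with the (quasi-)norm $\|x\|_p=\bigl(\sum_{i=1}^n|x_i|^p\bigr)^{1/p}$ if $p<\infty$ and $\|x\|_\infty=\max_{1\le i\le n}|x_i|$, and let $B_p^n=\{x\in\mathbb{R}^n:\|x\|_p\le 1\}$. For $0<p,q\le\infty$ and an integer $k\ge1$, the $k$-th (dyadic) entropy number of the identity $\mathrm{id}:\ell_p^n\to\ell_q^n$ is $$e_k(\mathrm{id}:\ell_p^n\to\ell_q^n)=\inf\Bigl\{r>0:\ \exists\, y_1,\dots,y_{2^{k-1}}\in\mathbb{R}^n\ \text{with}\ B_p^n\subset\bigcup_{j=1}^{2^{k-1}}(y_j+rB_q^n)\Bigr\}.$$ Let $0<p,q\le\infty$, and put $1/\infty=0$. There are constants $c,C>0$, depending only on $p$ and $q$, such that, writing $e_k=e_k(\mathrm{id}:\ell_p^n\to\ell_q^n)$, the following holds for all integers $n,k\ge1$. (a) If $p\le q$, then $c\,\beta\le e_k\le C\,\beta$, where $$\beta=\begin{cases}1 & \text{if } 1\le k\le\log_2 n,\\ \Bigl(\dfrac{\log_2(1+n/k)}{k}\Bigr)^{1/p-1/q}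 & \text{if } \log_2 n\le k\le n,\\ 2^{-(k-1)/n}\,n^{1/q-1/p} & \text{if } k\ge n;\end{cases}$$ where two of these ranges overlap, the estimate holds with either value of $\beta$. (b) If $q\le p$, then $c\,2^{-(k-1)/n}\,n^{1/q-1/p}\le e_k\le C\,2^{-(k-1)/n}\,n^{1/q-1/p}$. -/

import Mathlib

open scoped ENNReal Pointwise

noncomputable section

/-- The closed unit ball `B_X = {x | ‖x‖ ≤ 1}`. Only the function `‖·‖` is used, so that this makes
sense for quasi-norms (`Norm` carries no triangle inequality). -/
def quasiUnitBall (X : Type*) [Norm X] : Set X := {x | ‖x‖ ≤ 1}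

/-- The `k`-th dyadic entropy number (`k ≥ 1`) of a linear operator `T : X → Y`: the infimum of all
`r > 0` such that `T(B_X)` is covered by `2^(k-1)` translates of `r B_Y`. -/
def entropyNumber {X Y : Type*} [AddCommGroup X] [Module ℝ X] [Norm X]
    [AddCommGroup Y] [Module ℝ Y] [Norm Y] (k : ℕ) (T : X →ₗ[ℝ] Y) : ℝ :=
  sInf {r : ℝ | 0 < r ∧ ∃ y : Fin (2 ^ (k - 1)) → Y,
    T '' quasiUnitBall X ⊆ ⋃ j, (y j +ᵥ r • quasiUnitBall Y)}

/-- The real space `ℓ_p^n`, for every `0 < p ≤ ∞`. Its norm in Mathlib is `(∑ |x i| ^ p) ^ (1 / p)`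
for `0 < p < ∞` and `max |x i|` for `p = ∞`, also when `p < 1`. -/
abbrev lpSpace (p : ℝ≥0∞) (n : ℕ) : Type := PiLp p (fun _ : Fin n => ℝ)

/-- The identity `ℓ_p^n → ℓ_q^n`. -/
def lpId (p q : ℝ≥0∞) (n : ℕ) : lpSpace p n →ₗ[ℝ] lpSpace q n :=
  ((WithLp.linearEquiv p ℝ (Fin n → ℝ)).trans
    (WithLp.linearEquiv q ℝ (Fin n → ℝ)).symm).toLinearMap

/-- The exponent `1/p`, with `1/∞ = 0`. -/
def recip (p : ℝ≥0∞) : ℝ := (p⁻¹).toReal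

end

/-!
All entropy estimates come from counting or measuring a set `{x | ∑ i, φ (x i) ≤ b}` by the
exponential Chebyshev inequality: its size is at most `exp (μ b) ∏ i ∑ t, exp (-μ φ (t))`. It is
used three times, for the volume of the ball `n^{1/q} B_q^n`, for the number of points of `ℤ^n` in
`ρ B_p^n`, and for the number of words in a Hamming ball.

Upper bounds: rounding the coordinates of `ρ x` towards `0`, for `x` in `B_p^n`, gives a point of
`ℤ^n` in `ρ B_p^n`, with an error that scales back to coordinates at most `ρ⁻¹`. For `k ≥ n` one
takes `ρ` of the order `2^{k/n} n^{1/p}`, for `log₂ n ≤ k ≤ n` of the order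
`(k / log₂ (1 + n/k))^{1/p}`.

Lower bounds: comparing volumes for `k` at least of the order of `n`. For smaller `k` one splits the
coordinates into `m` blocks and packs the vectors with one nonzero entry `m^{-1/p}` in each block:
there are many more of these words than words in a Hamming ball of radius `m/2`, and two words far
apart in the Hamming distance give vectors far apart in `ℓ_q^n`.
-/

open Finset MeasureTheory

section EntropyNumbers

variable {X Y : Type*} [AddCommGroup X] [Module ℝ X] [Norm X] [AddCommGroup Y] [Module ℝ Y]
  [Norm Y] {k l : ℕ} {r c : ℝ} {T : X →ₗ[ℝ] Y}

/-- The radii `r > 0` for which `T(B_X)` is covered by `2^(k-1)` translates of `r B_Y`; the entropy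
number is the infimum of this set. -/
def coveringRadii (k : ℕ) (T : X →ₗ[ℝ] Y) : Set ℝ :=
  {r | 0 < r ∧ ∃ y : Fin (2 ^ (k - 1)) → Y,
    T '' quasiUnitBall X ⊆ ⋃ j, (y j +ᵥ r • quasiUnitBall Y)}

theorem bddBelow_coveringRadii (k : ℕ) (T : X →ₗ[ℝ] Y) : BddBelow (coveringRadii k T) :=
  ⟨0, fun _ hr => hr.1.le⟩

theorem entropyNumber_le_of_mem (hr : r ∈ coveringRadii k T) : entropyNumber k T ≤ r :=
  csInf_le (bddBelow_coveringRadii k T) hr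

theorem le_entropyNumber (hne : (coveringRadii k T).Nonempty)
    (hc : ∀ r ∈ coveringRadii k T, c ≤ r) : c ≤ entropyNumber k T :=
  le_csInf hne hc

theorem mem_coveringRadii_of_card_le {α : Type*} [Fintype α] (hα : Fintype.card α ≤ 2 ^ (k - 1))
    (hr : 0 < r) (y : α → Y) (hy : T '' quasiUnitBall X ⊆ ⋃ a, (y a +ᵥ r • quasiUnitBall Y)) :
    r ∈ coveringRadii k T := by
  obtain ⟨e⟩ := Function.Embedding.nonempty_of_card_le (hα.trans_eq (Fintype.card_fin _).symm)
  refine ⟨hr, Function.extend e y 0, hy.trans (Set.iUnion_subset fun a => ?_)⟩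
  rw [← e.injective.extend_apply y 0 a]
  exact Set.subset_iUnion (fun j => Function.extend e y 0 j +ᵥ r • quasiUnitBall Y) (e a)

theorem coveringRadii_mono (hkl : k ≤ l) : coveringRadii k T ⊆ coveringRadii l T := by
  rintro r ⟨hr, y, hy⟩
  refine mem_coveringRadii_of_card_le ?_ hr y hy
  rw [Fintype.card_fin]
  exact Nat.pow_le_pow_right two_pos (Nat.sub_le_sub_right hkl 1)

theorem entropyNumber_anti (hne : (coveringRadii k T).Nonempty) (hkl : k ≤ l) :
    entropyNumber l T ≤ entropyNumber k T :=
  csInf_le_csInf (bddBelow_coveringRadii l T) hne (coveringRadii_mono hkl)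

end EntropyNumbers

section Recip

theorem recip_eq_inv_toReal (p : ℝ≥0∞) : recip p = p.toReal⁻¹ := ENNReal.toReal_inv p

theorem recip_nonneg (p : ℝ≥0∞) : 0 ≤ recip p := ENNReal.toReal_nonneg

theorem recip_top : recip ⊤ = 0 := by simp [recip]

theorem recip_le_recip {p q : ℝ≥0∞} (hp : 0 < p) (hpq : p ≤ q) : recip q ≤ recip p :=
  ENNReal.toReal_mono (ENNReal.inv_ne_top.2 hp.ne') (ENNReal.inv_le_inv.2 hpq)

end Recip

section EllNorm

variable {ι : Type*} [Fintype ι] {p q : ℝ≥0∞} {x y : ι → ℝ} {r v h : ℝ}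

/-- The quasi-norm of `ℓ_p` on plain functions, so that one vector can be measured in `ℓ_p` and in
`ℓ_q` without changing its type. -/
noncomputable def ellNorm (p : ℝ≥0∞) (x : ι → ℝ) : ℝ :=
  ‖(WithLp.toLp p x : PiLp p fun _ : ι => ℝ)‖

theorem ellNorm_top_le_iff (hr : 0 ≤ r) : ellNorm ⊤ x ≤ r ↔ ∀ i, |x i| ≤ r := by
  simp only [ellNorm, PiLp.norm_eq_ciSup, Real.norm_eq_abs]
  exact ⟨fun h i => (le_ciSup (f := fun i => |x i|) (Set.finite_range _).bddAbove i).trans h,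
    fun h => Real.iSup_le h hr⟩

theorem ellNorm_eq_sum (hp : 0 < p.toReal) :
    ellNorm p x = (∑ i, |x i| ^ p.toReal) ^ p.toReal⁻¹ := by
  simp only [ellNorm, PiLp.norm_eq_sum hp, Real.norm_eq_abs, one_div]

theorem ellNorm_le_iff (hp : 0 < p.toReal) (hr : 0 ≤ r) :
    ellNorm p x ≤ r ↔ ∑ i, |x i| ^ p.toReal ≤ r ^ p.toReal := by
  rw [ellNorm_eq_sum hp]
  exact Real.rpow_inv_le_iff_of_pos (by positivity) hr hp

theorem ellNorm_nonneg (hp : 0 < p) : 0 ≤ ellNorm p x := by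
  rcases eq_or_ne p ⊤ with rfl | hpt
  · rw [ellNorm, PiLp.norm_eq_ciSup]
    exact Real.iSup_nonneg fun _ => norm_nonneg _
  · rw [ellNorm_eq_sum (ENNReal.toReal_pos hp.ne' hpt)]
    positivity

theorem ellNorm_rpow_toReal (hp : 0 < p.toReal) :
    ellNorm p x ^ p.toReal = ∑ i, |x i| ^ p.toReal := by
  rw [ellNorm_eq_sum hp, Real.rpow_inv_rpow (by positivity) hp.ne']

theorem ellNorm_smul (hp : 0 < p) (c : ℝ) (x : ι → ℝ) :
    ellNorm p (c • x) = |c| * ellNorm p x := by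
  rcases eq_or_ne p ⊤ with rfl | hpt
  · simp only [ellNorm, PiLp.norm_eq_ciSup, Pi.smul_apply, smul_eq_mul, norm_mul,
      Real.norm_eq_abs, Real.mul_iSup_of_nonneg (abs_nonneg c)]
  · have hp' := ENNReal.toReal_pos hp.ne' hpt
    simp only [ellNorm_eq_sum hp', Pi.smul_apply, smul_eq_mul, abs_mul,
      Real.mul_rpow (abs_nonneg _) (abs_nonneg _), ← mul_sum]
    rw [Real.mul_rpow (by positivity) (by positivity), Real.rpow_rpow_inv (abs_nonneg _) hp'.ne']

theorem abs_apply_le_ellNorm (hp : 0 < p) (i : ι) : |x i| ≤ ellNorm p x := by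
  rcases eq_or_ne p ⊤ with rfl | hpt
  · exact (ellNorm_top_le_iff (ellNorm_nonneg hp)).1 le_rfl i
  · have hp' := ENNReal.toReal_pos hp.ne' hpt
    rw [← Real.rpow_le_rpow_iff (abs_nonneg _) (ellNorm_nonneg hp) hp', ellNorm_rpow_toReal hp']
    exact single_le_sum (f := fun i => |x i| ^ p.toReal) (fun i _ => by positivity) (mem_univ i)

theorem ellNorm_mono (hp : 0 < p) (hxy : ∀ i, |x i| ≤ |y i|) : ellNorm p x ≤ ellNorm p y := by
  rcases eq_or_ne p ⊤ with rfl | hpt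
  · exact (ellNorm_top_le_iff (ellNorm_nonneg hp)).2
      fun i => (hxy i).trans (abs_apply_le_ellNorm hp i)
  · have hp' := ENNReal.toReal_pos hp.ne' hpt
    rw [ellNorm_le_iff hp' (ellNorm_nonneg hp), ellNorm_rpow_toReal hp']
    exact sum_le_sum fun i _ => Real.rpow_le_rpow (abs_nonneg _) (hxy i) hp'.le

theorem ellNorm_le_mul_card_rpow (hq : 0 < q) (hv : 0 ≤ v) {S : Finset ι}
    (hS : ∀ i ∉ S, x i = 0) (hx : ∀ i ∈ S, |x i| ≤ v) :
    ellNorm q x ≤ v * (#S : ℝ) ^ recip q := by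
  rcases eq_or_ne q ⊤ with rfl | hqt
  · rw [recip_top, Real.rpow_zero, mul_one, ellNorm_top_le_iff hv]
    intro i
    by_cases hi : i ∈ S
    · exact hx i hi
    · simpa [hS i hi] using hv
  · have hq' := ENNReal.toReal_pos hq.ne' hqt
    rw [ellNorm_le_iff hq' (by positivity), Real.mul_rpow hv (by positivity),
      recip_eq_inv_toReal, Real.rpow_inv_rpow (by positivity) hq'.ne']
    calc ∑ i, |x i| ^ q.toReal = ∑ i ∈ S, |x i| ^ q.toReal := by
          refine (sum_subset S.subset_univ fun i _ hi => ?_).symm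
          rw [hS i hi, abs_zero, Real.zero_rpow hq'.ne']
      _ ≤ ∑ _i ∈ S, v ^ q.toReal := by
          gcongr with i hi
          exact hx i hi
      _ = v ^ q.toReal * #S := by rw [sum_const, nsmul_eq_mul, mul_comm]

theorem mul_card_rpow_le_ellNorm (hq : 0 < q) (hv : 0 ≤ v) {S : Finset ι} (hS : S.Nonempty)
    (hx : ∀ i ∈ S, v ≤ |x i|) : v * (#S : ℝ) ^ recip q ≤ ellNorm q x := by
  rcases eq_or_ne q ⊤ with rfl | hqt
  · obtain ⟨i, hi⟩ := hS
    rw [recip_top, Real.rpow_zero, mul_one]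
    exact (hx i hi).trans (abs_apply_le_ellNorm hq i)
  · have hq' := ENNReal.toReal_pos hq.ne' hqt
    rw [← Real.rpow_le_rpow_iff (by positivity) (ellNorm_nonneg hq) hq', ellNorm_rpow_toReal hq',
      Real.mul_rpow hv (by positivity), recip_eq_inv_toReal,
      Real.rpow_inv_rpow (by positivity) hq'.ne']
    calc v ^ q.toReal * #S = ∑ _i ∈ S, v ^ q.toReal := by rw [sum_const, nsmul_eq_mul, mul_comm]
      _ ≤ ∑ i ∈ S, |x i| ^ q.toReal := by
          gcongr with i hi
          exact hx i hi
      _ ≤ ∑ i, |x i| ^ q.toReal :=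
          sum_le_sum_of_subset_of_nonneg S.subset_univ fun i _ _ => by positivity

theorem ellNorm_sub_le (hq : 0 < q) :
    ellNorm q (x - y) ≤ 2 * 2 ^ recip q * max (ellNorm q x) (ellNorm q y) := by
  set M := max (ellNorm q x) (ellNorm q y)
  have hM : 0 ≤ M := (ellNorm_nonneg hq).trans (le_max_left _ _)
  rcases eq_or_ne q ⊤ with rfl | hqt
  · rw [ellNorm_top_le_iff (by positivity)]
    intro i
    have hx : |x i| ≤ M := (abs_apply_le_ellNorm hq i).trans (le_max_left _ _)
    have hy : |y i| ≤ M := (abs_apply_le_ellNorm hq i).trans (le_max_right _ _)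
    rw [recip_top, Real.rpow_zero, mul_one, two_mul]
    exact (abs_sub _ _).trans (add_le_add hx hy)
  · have hq' := ENNReal.toReal_pos hq.ne' hqt
    have hx := (ellNorm_le_iff hq' hM).1 (le_max_left (ellNorm q x) (ellNorm q y))
    have hy := (ellNorm_le_iff hq' hM).1 (le_max_right (ellNorm q x) (ellNorm q y))
    have hterm (i : ι) : |(x - y) i| ^ q.toReal
        ≤ 2 ^ q.toReal * (|x i| ^ q.toReal + |y i| ^ q.toReal) := by
      calc |(x - y) i| ^ q.toReal ≤ (2 * max |x i| |y i|) ^ q.toReal := by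
            gcongr
            rw [two_mul]
            exact (abs_sub _ _).trans (add_le_add (le_max_left _ _) (le_max_right _ _))
        _ = 2 ^ q.toReal * max |x i| |y i| ^ q.toReal :=
            Real.mul_rpow two_pos.le (by positivity)
        _ ≤ 2 ^ q.toReal * (|x i| ^ q.toReal + |y i| ^ q.toReal) := by
            gcongr
            rcases max_choice |x i| |y i| with h | h <;> rw [h]
            · exact le_add_of_nonneg_right (by positivity)
            · exact le_add_of_nonneg_left (by positivity)
    rw [ellNorm_le_iff hq' (by positivity), Real.mul_rpow (by positivity) hM,
      Real.mul_rpow two_pos.le (by positivity), recip_eq_inv_toReal,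
      Real.rpow_inv_rpow two_pos.le hq'.ne']
    calc ∑ i, |(x - y) i| ^ q.toReal
        ≤ ∑ i, 2 ^ q.toReal * (|x i| ^ q.toReal + |y i| ^ q.toReal) :=
          sum_le_sum fun i _ => hterm i
      _ = 2 ^ q.toReal * (∑ i, |x i| ^ q.toReal + ∑ i, |y i| ^ q.toReal) := by
          rw [← mul_sum, sum_add_distrib]
      _ ≤ 2 ^ q.toReal * (M ^ q.toReal + M ^ q.toReal) := by gcongr
      _ = 2 ^ q.toReal * 2 * M ^ q.toReal := by ring

theorem ellNorm_le_rpow_mul_rpow (hp : 0 < p) (hpt : p ≠ ⊤) (hpq : p ≤ q) (hh : 0 ≤ h)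
    (hx : ∀ i, |x i| ≤ h) :
    ellNorm q x ≤ h ^ (1 - p.toReal * recip q) * ellNorm p x ^ (p.toReal * recip q) := by
  rcases eq_or_ne q ⊤ with rfl | hqt
  · simpa [recip_top, ellNorm_top_le_iff hh] using hx
  have hp' := ENNReal.toReal_pos hp.ne' hpt
  have hq' := ENNReal.toReal_pos (hp.trans_le hpq).ne' hqt
  have hpq' : p.toReal ≤ q.toReal := ENNReal.toReal_mono hqt hpq
  have hN : 0 ≤ ellNorm p x := ellNorm_nonneg hp
  have h₁ : (1 - p.toReal * recip q) * q.toReal = q.toReal - p.toReal := by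
    rw [recip_eq_inv_toReal]; field_simp
  have h₂ : p.toReal * recip q * q.toReal = p.toReal := by
    rw [recip_eq_inv_toReal]; field_simp
  rw [ellNorm_le_iff hq' (by positivity), Real.mul_rpow (by positivity) (by positivity),
    ← Real.rpow_mul hh, ← Real.rpow_mul hN, h₁, h₂, ellNorm_rpow_toReal hp', mul_sum]
  gcongr with i
  calc |x i| ^ q.toReal = |x i| ^ (q.toReal - p.toReal) * |x i| ^ p.toReal := by
        rw [← Real.rpow_add_of_nonneg (abs_nonneg _) (sub_nonneg.2 hpq') hp'.le, sub_add_cancel]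
    _ ≤ h ^ (q.toReal - p.toReal) * |x i| ^ p.toReal := by
        gcongr ?_ * _
        exact Real.rpow_le_rpow (abs_nonneg _) (hx i) (sub_nonneg.2 hpq')

theorem ellNorm_le_ellNorm (hp : 0 < p) (hpq : p ≤ q) : ellNorm q x ≤ ellNorm p x := by
  rcases eq_or_ne p ⊤ with rfl | hpt
  · rw [top_le_iff.1 hpq]
  · have hp' := ENNReal.toReal_pos hp.ne' hpt
    have hθ : p.toReal * recip q ≤ 1 := by
      rw [← mul_inv_cancel₀ hp'.ne', ← recip_eq_inv_toReal]
      gcongr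
      exact recip_le_recip hp hpq
    refine (ellNorm_le_rpow_mul_rpow hp hpt hpq (ellNorm_nonneg hp)
      (abs_apply_le_ellNorm hp)).trans_eq ?_
    rw [← Real.rpow_add_of_nonneg (ellNorm_nonneg hp) (sub_nonneg.2 hθ)
      (mul_nonneg hp'.le (recip_nonneg q)), sub_add_cancel, Real.rpow_one]

theorem ellNorm_le_card_rpow_mul (hq : 0 < q) (hqp : q ≤ p) :
    ellNorm q x ≤ (Fintype.card ι : ℝ) ^ (recip q - recip p) * ellNorm p x := by
  have hp : 0 < p := hq.trans_le hqp
  have hN : 0 ≤ ellNorm p x := ellNorm_nonneg hp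
  rcases eq_or_ne p ⊤ with rfl | hpt
  · rw [recip_top, sub_zero, mul_comm, ← card_univ]
    exact ellNorm_le_mul_card_rpow hq hN (by simp) fun i _ => abs_apply_le_ellNorm hp i
  have hp' := ENNReal.toReal_pos hp.ne' hpt
  have hq' := ENNReal.toReal_pos hq.ne' (ne_top_of_le_ne_top hpt hqp)
  have hqp' : q.toReal ≤ p.toReal := ENNReal.toReal_mono hpt hqp
  have hpow : (∑ i, |x i| ^ q.toReal) ^ (p.toReal / q.toReal)
      ≤ (Fintype.card ι : ℝ) ^ (p.toReal / q.toReal - 1) * ∑ i, |x i| ^ p.toReal := by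
    simpa only [← Real.rpow_mul (abs_nonneg _), mul_div_cancel₀ _ hq'.ne', card_univ] using
      Real.rpow_sum_le_const_mul_sum_rpow_of_nonneg univ (f := fun i => |x i| ^ q.toReal)
        ((one_le_div hq').2 hqp') (fun i _ => by positivity)
  have he : (recip q - recip p) * p.toReal = p.toReal / q.toReal - 1 := by
    rw [recip_eq_inv_toReal, recip_eq_inv_toReal]; field_simp
  rw [← ellNorm_rpow_toReal hq', ← ellNorm_rpow_toReal hp', ← Real.rpow_mul (ellNorm_nonneg hq),
    mul_div_cancel₀ _ hq'.ne'] at hpow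
  rwa [← Real.rpow_le_rpow_iff (ellNorm_nonneg hq) (by positivity) hp',
    Real.mul_rpow (by positivity) hN, ← Real.rpow_mul (by positivity), he]

end EllNorm

section LpId

variable {p q : ℝ≥0∞} {n k : ℕ} {r c : ℝ}

theorem toLp_mem_vadd_smul_quasiUnitBall_iff (hq : 0 < q) (hr : 0 < r) (x y : Fin n → ℝ) :
    (WithLp.toLp q x : lpSpace q n) ∈
      (WithLp.toLp q y : lpSpace q n) +ᵥ r • quasiUnitBall (lpSpace q n) ↔
      ellNorm q (x - y) ≤ r := by
  rw [Set.mem_vadd_set_iff_neg_vadd_mem, Set.mem_smul_set_iff_inv_smul_mem₀ hr.ne']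
  change ellNorm q (r⁻¹ • (-y + x)) ≤ 1 ↔ _
  rw [neg_add_eq_sub, ellNorm_smul hq, abs_of_pos (inv_pos.2 hr), inv_mul_le_one₀ hr]

theorem lpId_image_subset_iff (hq : 0 < q) (hr : 0 < r) {α : Type*} (y : α → lpSpace q n) :
    lpId p q n '' quasiUnitBall (lpSpace p n) ⊆ ⋃ a, (y a +ᵥ r • quasiUnitBall (lpSpace q n)) ↔
      ∀ x, ellNorm p x ≤ 1 → ∃ a, ellNorm q (x - (y a).ofLp) ≤ r := by
  constructor
  · intro h x hx
    obtain ⟨a, ha⟩ := Set.mem_iUnion.1 (h ⟨WithLp.toLp p x, hx, rfl⟩)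
    exact ⟨a, (toLp_mem_vadd_smul_quasiUnitBall_iff hq hr x (y a).ofLp).1 ha⟩
  · rintro h _ ⟨x, hx, rfl⟩
    obtain ⟨a, ha⟩ := h x.ofLp hx
    exact Set.mem_iUnion.2 ⟨a, (toLp_mem_vadd_smul_quasiUnitBall_iff hq hr x.ofLp (y a).ofLp).2 ha⟩

theorem mem_coveringRadii_lpId (hq : 0 < q) (hr : 0 < r) {α : Type*} [Fintype α]
    (hα : Fintype.card α ≤ 2 ^ (k - 1)) (y : α → Fin n → ℝ)
    (hy : ∀ x, ellNorm p x ≤ 1 → ∃ a, ellNorm q (x - y a) ≤ r) :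
    r ∈ coveringRadii k (lpId p q n) :=
  mem_coveringRadii_of_card_le hα hr (fun a => WithLp.toLp q (y a))
    ((lpId_image_subset_iff hq hr _).2 hy)

theorem mem_coveringRadii_lpId_of_forall_ellNorm_le (hq : 0 < q) (hr : 0 < r)
    (h : ∀ x : Fin n → ℝ, ellNorm p x ≤ 1 → ellNorm q x ≤ r) :
    r ∈ coveringRadii k (lpId p q n) :=
  mem_coveringRadii_lpId hq hr (α := Unit) (by simpa using Nat.one_le_two_pow) 0
    fun x hx => ⟨(), by simpa using h x hx⟩

theorem coveringRadii_lpId_nonempty (hp : 0 < p) (hq : 0 < q) (hn : 1 ≤ n) :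
    (coveringRadii k (lpId p q n)).Nonempty := by
  have hn' : (0 : ℝ) < n := by exact_mod_cast hn
  refine ⟨1 * (#(univ : Finset (Fin n)) : ℝ) ^ recip q,
    mem_coveringRadii_lpId_of_forall_ellNorm_le hq ?_ fun x hx => ?_⟩
  · simpa using Real.rpow_pos_of_pos hn' _
  · exact ellNorm_le_mul_card_rpow hq zero_le_one (by simp)
      fun i _ => (abs_apply_le_ellNorm hp i).trans hx

theorem le_entropyNumber_lpId (hp : 0 < p) (hq : 0 < q) (hn : 1 ≤ n)
    (h : ∀ r : ℝ, 0 < r → ∀ y : Fin (2 ^ (k - 1)) → Fin n → ℝ,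
      (∀ x, ellNorm p x ≤ 1 → ∃ j, ellNorm q (x - y j) ≤ r) → c ≤ r) :
    c ≤ entropyNumber k (lpId p q n) := by
  refine le_entropyNumber (coveringRadii_lpId_nonempty hp hq hn) ?_
  rintro r ⟨hr, y, hy⟩
  exact h r hr (fun j => (y j).ofLp) ((lpId_image_subset_iff hq hr y).1 hy)

theorem entropyNumber_lpId_le_one (hp : 0 < p) (hpq : p ≤ q) :
    entropyNumber k (lpId p q n) ≤ 1 :=
  entropyNumber_le_of_mem <| mem_coveringRadii_lpId_of_forall_ellNorm_le (hp.trans_le hpq) one_pos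
    fun _ hx => (ellNorm_le_ellNorm hp hpq).trans hx

theorem entropyNumber_lpId_le_card_rpow (hq : 0 < q) (hqp : q ≤ p) (hn : 1 ≤ n) :
    entropyNumber k (lpId p q n) ≤ (n : ℝ) ^ (recip q - recip p) := by
  have hn' : (0 : ℝ) < n := by exact_mod_cast hn
  have hr := Real.rpow_pos_of_pos hn' (recip q - recip p)
  refine entropyNumber_le_of_mem <| mem_coveringRadii_lpId_of_forall_ellNorm_le hq hr
    fun x hx => ?_
  simpa using (ellNorm_le_card_rpow_mul hq hqp).trans (mul_le_of_le_one_right (by positivity) hx)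

end LpId

section Rates

/-- The `n`-th root of `2^(-(k-1))`, the factor by which the radii of `2^(k-1)` balls filling a body
in `ℝ^n` shrink. -/
noncomputable def dyadicRate (n k : ℕ) : ℝ := (2 : ℝ) ^ (-(((k : ℝ) - 1) / (n : ℝ)))

/-- The rate of `e_k(id : ℓ_p^n → ℓ_q^n)` for `k ≥ n`, where volumes decide. -/
noncomputable def volumeRate (p q : ℝ≥0∞) (n k : ℕ) : ℝ :=
  dyadicRate n k * (n : ℝ) ^ (recip q - recip p)

/-- The rate of `e_k(id : ℓ_p^n → ℓ_q^n)` for `p ≤ q` and `log₂ n ≤ k ≤ n`, where sparse vectors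
decide. -/
noncomputable def sparseRate (p q : ℝ≥0∞) (n k : ℕ) : ℝ :=
  (Real.logb 2 (1 + (n : ℝ) / (k : ℝ)) / (k : ℝ)) ^ (recip p - recip q)

variable {p q : ℝ≥0∞} {n k : ℕ}

theorem dyadicRate_pos (n k : ℕ) : 0 < dyadicRate n k := Real.rpow_pos_of_pos two_pos _

theorem dyadicRate_pow (hn : n ≠ 0) (hk : 1 ≤ k) : dyadicRate n k ^ n = (2 ^ (k - 1))⁻¹ := by
  have hn' : (n : ℝ) ≠ 0 := Nat.cast_ne_zero.2 hn
  rw [dyadicRate, ← Real.rpow_mul_natCast two_pos.le, neg_mul, div_mul_cancel₀ _ hn',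
    Real.rpow_neg two_pos.le, ← Nat.cast_pred hk, Real.rpow_natCast]

end Rates

section Volume

/-- The mass `∫ exp(-|t|^p) dt = 2 Γ(1/p + 1)`, which at `p = ∞` is the length of the limiting
interval `[-1, 1]`. -/
noncomputable def expMass (p : ℝ≥0∞) : ℝ := 2 * Real.Gamma (recip p + 1)

theorem expMass_pos (p : ℝ≥0∞) : 0 < expMass p :=
  mul_pos two_pos (Real.Gamma_pos_of_pos (add_pos_of_nonneg_of_pos (recip_nonneg p) one_pos))

theorem expMass_top : expMass ⊤ = 2 := by simp [expMass, recip_top]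

theorem integral_exp_neg_abs_rpow {p : ℝ≥0∞} (hp : 0 < p.toReal) :
    ∫ t : ℝ, Real.exp (-|t| ^ p.toReal) = expMass p := by
  rw [integral_comp_abs (f := fun t => Real.exp (-t ^ p.toReal)), integral_exp_neg_rpow hp,
    expMass, recip_eq_inv_toReal, one_div]

theorem integrable_exp_neg_abs_rpow {p : ℝ≥0∞} (hp : 0 < p.toReal) :
    Integrable fun t : ℝ => Real.exp (-|t| ^ p.toReal) :=
  .of_integral_ne_zero (by rw [integral_exp_neg_abs_rpow hp]; exact (expMass_pos p).ne')

theorem measure_le_of_subset_iUnion_vadd_smul {E : Type*} [NormedAddCommGroup E]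
    [NormedSpace ℝ E] [MeasurableSpace E] [BorelSpace E] [FiniteDimensional ℝ E] (μ : Measure E)
    [μ.IsAddHaarMeasure] {α : Type*} [Fintype α] {A B : Set E} {y : α → E} {r : ℝ} (hr : 0 ≤ r)
    (hA : A ⊆ ⋃ a, (y a +ᵥ r • B)) :
    μ A ≤ Fintype.card α * (ENNReal.ofReal (r ^ Module.finrank ℝ E) * μ B) :=
  calc μ A ≤ μ (⋃ a, (y a +ᵥ r • B)) := measure_mono hA
    _ ≤ ∑ a, μ (y a +ᵥ r • B) := measure_iUnion_fintype_le _ _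
    _ = Fintype.card α * (ENNReal.ofReal (r ^ Module.finrank ℝ E) * μ B) := by
      simp only [measure_vadd, Measure.addHaar_smul_of_nonneg μ hr, sum_const, card_univ,
        nsmul_eq_mul]

variable {ι : Type*} [Fintype ι] {p q : ℝ≥0∞} {n k : ℕ}

theorem volume_ellNorm_le_one_ge [Nonempty ι] (hp : 0 < p) :
    ENNReal.ofReal (((Fintype.card ι : ℝ) ^ (-recip p)) ^ Fintype.card ι) ≤
      volume {x : ι → ℝ | ellNorm p x ≤ 1} := by
  have hn : (0 : ℝ) < Fintype.card ι := by exact_mod_cast Fintype.card_pos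
  set h : ℝ := (Fintype.card ι : ℝ) ^ (-recip p) with hh
  have hcube : Set.Icc (fun _ => 0) (fun _ => h) ⊆ {x : ι → ℝ | ellNorm p x ≤ 1} := by
    intro x hx
    have hx' : ellNorm p x ≤ h * (#(univ : Finset ι) : ℝ) ^ recip p :=
      ellNorm_le_mul_card_rpow hp (by positivity) (by simp) fun i _ =>
        (abs_of_nonneg (hx.1 i)).trans_le (hx.2 i)
    rwa [card_univ, hh, ← Real.rpow_add hn, neg_add_cancel, Real.rpow_zero] at hx'
  calc ENNReal.ofReal (h ^ Fintype.card ι)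
      = volume (Set.Icc (fun _ : ι => (0 : ℝ)) (fun _ => h)) := by
        rw [Real.volume_Icc_pi]
        simp [ENNReal.ofReal_pow (show 0 ≤ h by positivity)]
    _ ≤ volume {x : ι → ℝ | ellNorm p x ≤ 1} := measure_mono hcube

theorem volume_ellNorm_le_card_rpow_le (hq : 0 < q) :
    volume {x : ι → ℝ | ellNorm q x ≤ (Fintype.card ι : ℝ) ^ recip q} ≤
      ENNReal.ofReal ((Real.exp 1 * expMass q) ^ Fintype.card ι) := by
  set n := Fintype.card ι
  rcases eq_or_ne q ⊤ with rfl | hqt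
  · have hcube : {x : ι → ℝ | ellNorm ⊤ x ≤ (n : ℝ) ^ recip ⊤} =
        Set.Icc (fun _ => -1) (fun _ => 1) := by
      ext x
      simp only [Set.mem_ofPred_eq, recip_top, Real.rpow_zero, ellNorm_top_le_iff zero_le_one,
        abs_le, Set.mem_Icc, Pi.le_def, forall_and]
    rw [hcube, Real.volume_Icc_pi, prod_const, card_univ, expMass_top,
      ENNReal.ofReal_pow (by positivity)]
    gcongr
    linarith [Real.one_le_exp zero_le_one]
  have hq' := ENNReal.toReal_pos hq.ne' hqt
  set f : (ι → ℝ) → ℝ := fun x => ∏ i, Real.exp (-|x i| ^ q.toReal)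
  have hf : Integrable f := .fintype_prod fun _ => integrable_exp_neg_abs_rpow hq'
  have hsub : {x : ι → ℝ | ellNorm q x ≤ (n : ℝ) ^ recip q} ⊆ {x | Real.exp (-n) ≤ f x} := by
    intro x hx
    rw [Set.mem_ofPred_eq, ellNorm_le_iff hq' (by positivity), recip_eq_inv_toReal,
      Real.rpow_inv_rpow (by positivity) hq'.ne'] at hx
    simpa only [f, Set.mem_ofPred_eq, ← Real.exp_sum, sum_neg_distrib, Real.exp_le_exp,
      neg_le_neg_iff] using hx
  have hmarkov : Real.exp (-n) * volume.real {x | Real.exp (-n) ≤ f x} ≤ expMass q ^ n := by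
    rw [← integral_exp_neg_abs_rpow hq',
      ← integral_fintype_prod_volume_eq_pow fun t : ℝ => Real.exp (-|t| ^ q.toReal)]
    exact mul_meas_ge_le_integral_of_nonneg
      (.of_forall fun x => prod_nonneg fun i _ => (Real.exp_pos _).le) hf _
  refine (measure_mono hsub).trans ?_
  rw [← ENNReal.ofReal_toReal (hf.measure_ge_lt_top (Real.exp_pos (-(n : ℝ)))).ne]
  refine ENNReal.ofReal_le_ofReal ?_
  rwa [mul_pow, ← Real.exp_nat_mul, mul_one, ← inv_mul_le_iff₀ (Real.exp_pos _), ← Real.exp_neg]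

theorem volumeRate_le_entropyNumber (hp : 0 < p) (hq : 0 < q) (hn : 1 ≤ n) (hk : 1 ≤ k) :
    (Real.exp 1 * expMass q)⁻¹ * volumeRate p q n k ≤ entropyNumber k (lpId p q n) := by
  refine le_entropyNumber_lpId hp hq hn fun r hr y hy => ?_
  have hn' : (0 : ℝ) < n := by exact_mod_cast hn
  have : Nonempty (Fin n) := ⟨⟨0, hn⟩⟩
  set K := Real.exp 1 * expMass q
  have hK : 0 < K := mul_pos (Real.exp_pos 1) (expMass_pos q)
  set R : ℝ := (n : ℝ) ^ recip q with hR
  have hR0 : 0 < R := Real.rpow_pos_of_pos hn' _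
  have hcover : {x : Fin n → ℝ | ellNorm p x ≤ 1} ⊆
      ⋃ j, (y j +ᵥ (r / R) • {x : Fin n → ℝ | ellNorm q x ≤ R}) := by
    intro x hx
    obtain ⟨j, hj⟩ := hy x hx
    refine Set.mem_iUnion.2 ⟨j, ?_⟩
    rw [Set.mem_vadd_set_iff_neg_vadd_mem, Set.mem_smul_set_iff_inv_smul_mem₀ (by positivity),
      Set.mem_ofPred_eq, vadd_eq_add, neg_add_eq_sub, ellNorm_smul hq, abs_of_pos (by positivity),
      inv_div, div_mul_eq_mul_div, div_le_iff₀ hr]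
    gcongr
  have hvol : ((n : ℝ) ^ (-recip p)) ^ n ≤ 2 ^ (k - 1) * ((r / R) ^ n * K ^ n) := by
    rw [← ENNReal.ofReal_le_ofReal_iff (by positivity), ENNReal.ofReal_mul (by positivity),
      ENNReal.ofReal_mul (by positivity), ENNReal.ofReal_pow two_pos.le, ENNReal.ofReal_ofNat]
    have hB := volume_ellNorm_le_card_rpow_le (ι := Fin n) hq
    have hA := volume_ellNorm_le_one_ge (ι := Fin n) hp
    have hcomp := measure_le_of_subset_iUnion_vadd_smul volume (by positivity) hcover
    simp only [Fintype.card_fin, Module.finrank_fin_fun, Nat.cast_pow, Nat.cast_ofNat]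
      at hA hB hcomp
    exact hA.trans (hcomp.trans (by gcongr))
  have hroot : dyadicRate n k * (n : ℝ) ^ (-recip p) ≤ r / R * K := by
    refine le_of_pow_le_pow_left₀ (by lia : n ≠ 0) (by positivity) ?_
    rwa [mul_pow, mul_pow, dyadicRate_pow (by lia) hk, inv_mul_le_iff₀ (by positivity)]
  rw [volumeRate, sub_eq_neg_add, Real.rpow_add hn', ← hR, inv_mul_le_iff₀ hK, ← mul_assoc,
    ← le_div_iff₀ hR0]
  exact hroot.trans_eq (by ring)

end Volume

section LatticePoints

theorem card_filter_sum_le_exp {ι : Type*} [Fintype ι] [DecidableEq ι] {κ : ι → Type*}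
    (A : ∀ i, Finset (κ i)) (φ : ∀ i, κ i → ℝ) {b μ : ℝ} (hμ : 0 ≤ μ) :
    (#{z ∈ Fintype.piFinset A | ∑ i, φ i (z i) ≤ b} : ℝ) ≤
      Real.exp (μ * b) * ∏ i, ∑ a ∈ A i, Real.exp (-(μ * φ i a)) := by
  rw [prod_univ_sum, mul_sum, cast_card]
  refine (sum_le_sum fun z hz => ?_).trans
    (sum_le_sum_of_subset_of_nonneg (filter_subset _ _) fun z _ _ => by positivity)
  rw [← Real.exp_sum, ← Real.exp_add, sum_neg_distrib, ← mul_sum, ← sub_eq_add_neg, ← mul_sub]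
  exact Real.one_le_exp (mul_nonneg hμ (sub_nonneg.2 (mem_filter.1 hz).2))

theorem sum_Icc_erase_zero_le_integral {g : ℝ → ℝ} (hg : AntitoneOn g (Set.Ici 0))
    (hg0 : ∀ t, 0 ≤ g t) (hint : IntegrableOn g (Set.Ioi 0)) (M : ℕ) :
    ∑ z ∈ (Icc (-(M : ℤ)) M).erase 0, g |(z : ℝ)| ≤ 2 * ∫ t in Set.Ioi 0, g t := by
  have heven : ∑ z ∈ (Icc (-(M : ℤ)) M).erase 0, g |(z : ℝ)|
      = 2 * ∑ i ∈ range M, g (0 + ((i + 1 : ℕ) : ℝ)) := by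
    have h := sum_Icc_of_even_eq_range (f := fun z : ℤ => g |(z : ℝ)|) (fun z => by simp) M
    rw [sum_range_succ', ← sum_erase_add _ _ (a := 0) (by simp)] at h
    simp only [nsmul_eq_mul, Int.cast_natCast, Nat.abs_cast, Int.cast_zero, abs_zero,
      Nat.cast_zero] at h
    simp only [zero_add]
    push_cast at h ⊢
    linarith
  rw [heven]
  gcongr
  calc ∑ i ∈ range M, g (0 + ((i + 1 : ℕ) : ℝ)) ≤ ∫ t in (0 : ℝ)..0 + M, g t :=
        (hg.mono Set.Icc_subset_Ici_self).sum_le_integral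
    _ = ∫ t in Set.Ioc 0 (0 + (M : ℝ)), g t := intervalIntegral.integral_of_le (by simp)
    _ ≤ ∫ t in Set.Ioi 0, g t :=
      setIntegral_mono_set hint (.of_forall hg0) (.of_forall fun t ht => ht.1)

variable {p q : ℝ≥0∞} {n k : ℕ} {ρ r : ℝ}

theorem sum_erase_zero_exp_neg_mul_rpow_le (hp : 0 < p.toReal) {b : ℝ} (hb : 0 < b) (M : ℕ) :
    ∑ z ∈ (Icc (-(M : ℤ)) M).erase 0, Real.exp (-(b * |(z : ℝ)| ^ p.toReal)) ≤
      expMass p * b ^ (-recip p) := by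
  have hanti : AntitoneOn (fun t : ℝ => Real.exp (-b * t ^ p.toReal)) (Set.Ici 0) := by
    intro s (hs : 0 ≤ s) t _ hst
    simp only [neg_mul]
    gcongr
  have hint : IntegrableOn (fun t : ℝ => Real.exp (-b * t ^ p.toReal)) (Set.Ioi 0) := by
    simpa using integrableOn_rpow_mul_exp_neg_mul_rpow (s := 0) neg_one_lt_zero hp hb
  have h := sum_Icc_erase_zero_le_integral hanti (fun t => (Real.exp_pos _).le) hint M
  rw [integral_exp_neg_mul_rpow hp hb] at h
  simp only [neg_mul] at h
  refine h.trans_eq ?_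
  rw [expMass, recip_eq_inv_toReal, neg_div, one_div]
  ring

theorem sum_erase_zero_exp_neg_mul_rpow_le_exp (hp : 0 < p.toReal) {l : ℝ} (hl : 1 ≤ l) (M : ℕ) :
    ∑ z ∈ (Icc (-(M : ℤ)) M).erase 0, Real.exp (-(l * |(z : ℝ)| ^ p.toReal)) ≤
      expMass p * Real.exp (1 - l) := by
  have hterm (z : ℤ) (hz : z ∈ (Icc (-(M : ℤ)) M).erase 0) :
      Real.exp (-(l * |(z : ℝ)| ^ p.toReal)) ≤
        Real.exp (-(1 * |(z : ℝ)| ^ p.toReal)) * Real.exp (1 - l) := by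
    have hz1 : (1 : ℝ) ≤ |(z : ℝ)| := by exact_mod_cast Int.one_le_abs (mem_erase.1 hz).1
    have hz2 : 1 ≤ |(z : ℝ)| ^ p.toReal := Real.one_le_rpow hz1 hp.le
    rw [← Real.exp_add]
    exact Real.exp_le_exp.2 (by nlinarith)
  refine (sum_le_sum hterm).trans ?_
  rw [← sum_mul]
  gcongr
  simpa using sum_erase_zero_exp_neg_mul_rpow_le hp one_pos M

/-- The points of `ℤ^n` in the ball `ρ B_p^n`; the box, which contains them all, makes the set
finite. -/
noncomputable def latticeBall (p : ℝ≥0∞) (n : ℕ) (ρ : ℝ) : Finset (Fin n → ℤ) :=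
  {z ∈ Fintype.piFinset fun _ => Icc (-(⌊ρ⌋₊ : ℤ)) ⌊ρ⌋₊ | ellNorm p (fun i => (z i : ℝ)) ≤ ρ}

theorem mem_latticeBall (hp : 0 < p) {z : Fin n → ℤ} :
    z ∈ latticeBall p n ρ ↔ ellNorm p (fun i => (z i : ℝ)) ≤ ρ := by
  refine mem_filter.trans (and_iff_right_of_imp fun hz => Fintype.mem_piFinset.2 fun i => ?_)
  have hzi : ((z i).natAbs : ℝ) ≤ ρ := by
    rw [Nat.cast_natAbs, Int.cast_abs]
    exact (abs_apply_le_ellNorm (x := fun i => (z i : ℝ)) hp i).trans hz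
  have := Nat.le_floor hzi
  rw [mem_Icc]
  lia

theorem card_latticeBall_le_of_sum_le (hp : 0 < p.toReal) (hρ : 0 ≤ ρ) {μ S : ℝ} (hμ : 0 ≤ μ)
    (hS : ∀ M : ℕ, ∑ z ∈ (Icc (-(M : ℤ)) M).erase 0, Real.exp (-(μ * |(z : ℝ)| ^ p.toReal)) ≤ S) :
    (#(latticeBall p n ρ) : ℝ) ≤ Real.exp (μ * ρ ^ p.toReal) * (1 + S) ^ n := by
  have hsum : ∑ z ∈ Icc (-(⌊ρ⌋₊ : ℤ)) ⌊ρ⌋₊, Real.exp (-(μ * |(z : ℝ)| ^ p.toReal)) ≤ 1 + S := by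
    rw [← add_sum_erase _ _ (a := 0) (by simp), Int.cast_zero, abs_zero, Real.zero_rpow hp.ne',
      mul_zero, neg_zero, Real.exp_zero]
    gcongr
    exact hS _
  rw [latticeBall, filter_congr fun z _ => ellNorm_le_iff hp hρ]
  refine (card_filter_sum_le_exp (κ := fun _ : Fin n => ℤ) _
    (fun _ z => |(z : ℝ)| ^ p.toReal) hμ).trans ?_
  rw [prod_const, card_univ, Fintype.card_fin]
  gcongr

theorem card_latticeBall_top_le {t : ℝ} (ht : 1 ≤ t) :
    (#(latticeBall ⊤ n t) : ℝ) ≤ (3 * t) ^ n := by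
  have hbox : #(latticeBall ⊤ n t) ≤ (2 * ⌊t⌋₊ + 1) ^ n := by
    refine (card_filter_le _ _).trans_eq ?_
    rw [Fintype.card_piFinset, prod_const, card_univ, Fintype.card_fin, Int.card_Icc]
    congr 1
    lia
  have hfloor : (⌊t⌋₊ : ℝ) ≤ t := Nat.floor_le (by positivity)
  calc (#(latticeBall ⊤ n t) : ℝ) ≤ (2 * ⌊t⌋₊ + 1) ^ n := by exact_mod_cast hbox
    _ ≤ (3 * t) ^ n := by
      gcongr
      linarith

theorem card_latticeBall_mul_rpow_le (hp : 0 < p) {t : ℝ} (ht : 1 ≤ t) :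
    (#(latticeBall p n (t * (n : ℝ) ^ recip p)) : ℝ) ≤
      (Real.exp 1 * (1 + expMass p) * t) ^ n := by
  have hG := expMass_pos p
  rcases eq_or_ne p ⊤ with rfl | hpt
  · rw [recip_top, Real.rpow_zero, mul_one, expMass_top]
    refine (card_latticeBall_top_le ht).trans ?_
    gcongr
    linarith [Real.one_le_exp zero_le_one]
  have hp' := ENNReal.toReal_pos hp.ne' hpt
  have ht0 : 0 < t := by linarith
  have h := card_latticeBall_le_of_sum_le (n := n) (ρ := t * (n : ℝ) ^ recip p) hp' (by positivity)
    (by positivity : 0 ≤ t ^ (-p.toReal))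
    (sum_erase_zero_exp_neg_mul_rpow_le hp' (by positivity))
  have hμ : t ^ (-p.toReal) * (t * (n : ℝ) ^ recip p) ^ p.toReal = n := by
    rw [Real.mul_rpow ht0.le (by positivity), ← mul_assoc, ← Real.rpow_add ht0, neg_add_cancel,
      Real.rpow_zero, one_mul, recip_eq_inv_toReal, Real.rpow_inv_rpow (by positivity) hp'.ne']
  have hS : (t ^ (-p.toReal)) ^ (-recip p) = t := by
    rw [← Real.rpow_mul ht0.le, recip_eq_inv_toReal, neg_mul_neg, mul_inv_cancel₀ hp'.ne',
      Real.rpow_one]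
  rw [hμ, hS] at h
  calc (#(latticeBall p n (t * (n : ℝ) ^ recip p)) : ℝ)
      ≤ Real.exp n * (1 + expMass p * t) ^ n := h
    _ ≤ Real.exp n * (t + expMass p * t) ^ n := by gcongr
    _ = (Real.exp 1 * (1 + expMass p) * t) ^ n := by
      rw [← mul_one (n : ℝ), Real.exp_nat_mul, ← mul_pow]
      ring

theorem card_latticeBall_rpow_le_exp (hp : 0 < p.toReal) {m l : ℝ} (hm : 0 ≤ m) (hl : 1 ≤ l) :
    (#(latticeBall p n (m ^ recip p)) : ℝ) ≤
      Real.exp (l * m + n * (expMass p * Real.exp (1 - l))) := by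
  have hG := expMass_pos p
  have h := card_latticeBall_le_of_sum_le (n := n) (ρ := m ^ recip p) hp (by positivity)
    (zero_le_one.trans hl) (sum_erase_zero_exp_neg_mul_rpow_le_exp hp hl)
  rw [recip_eq_inv_toReal, Real.rpow_inv_rpow hm hp.ne'] at h
  rw [recip_eq_inv_toReal, Real.exp_add, Real.exp_nat_mul]
  refine h.trans ?_
  gcongr
  rw [add_comm]
  exact Real.add_one_le_exp _

theorem exists_int_round_toward_zero (t : ℝ) :
    ∃ z : ℤ, |t - z| ≤ 1 ∧ |t - z| ≤ |t| ∧ |(z : ℝ)| ≤ |t| := by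
  rcases le_total 0 t with ht | ht
  · have hle := Int.floor_le t
    have hlt := Int.lt_floor_add_one t
    have hnonneg : (0 : ℝ) ≤ ⌊t⌋ := by exact_mod_cast Int.floor_nonneg.2 ht
    refine ⟨⌊t⌋, ?_, ?_, ?_⟩ <;>
      simp only [abs_of_nonneg ht, abs_of_nonneg hnonneg, abs_of_nonneg (sub_nonneg.2 hle)] <;>
      linarith
  · have hle := Int.le_ceil t
    have hlt := Int.ceil_lt_add_one t
    have hnonpos : (⌈t⌉ : ℝ) ≤ 0 := by exact_mod_cast Int.ceil_le.2 (by simpa using ht)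
    refine ⟨⌈t⌉, ?_, ?_, ?_⟩ <;>
      simp only [abs_of_nonpos ht, abs_of_nonpos hnonpos, abs_of_nonpos (sub_nonpos.2 hle)] <;>
      linarith

theorem entropyNumber_le_of_card_latticeBall_le (hp : 0 < p) (hq : 0 < q) (hρ : 0 < ρ) (hr : 0 < r)
    (hcard : (#(latticeBall p n ρ) : ℝ) ≤ 2 ^ (k - 1))
    (hsmall : ∀ x : Fin n → ℝ, ellNorm p x ≤ 1 → (∀ i, |x i| ≤ ρ⁻¹) → ellNorm q x ≤ r) :
    entropyNumber k (lpId p q n) ≤ r := by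
  refine entropyNumber_le_of_mem <| mem_coveringRadii_lpId hq hr (α := latticeBall p n ρ)
    (by rw [Fintype.card_coe]; exact_mod_cast hcard) (fun z i => ρ⁻¹ * (z.1 i : ℝ)) fun x hx => ?_
  choose z hz1 hzx hz using fun i => exists_int_round_toward_zero (ρ * x i)
  have hmem : z ∈ latticeBall p n ρ := by
    rw [mem_latticeBall hp]
    calc ellNorm p (fun i => (z i : ℝ)) ≤ ellNorm p (ρ • x) := ellNorm_mono hp hz
      _ = ρ * ellNorm p x := by rw [ellNorm_smul hp, abs_of_pos hρ]
      _ ≤ ρ := mul_le_of_le_one_right hρ.le hx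
  have herr (i : Fin n) : |x i - ρ⁻¹ * z i| = ρ⁻¹ * |ρ * x i - z i| := by
    rw [← abs_of_pos (inv_pos.2 hρ), ← abs_mul, mul_sub, abs_of_pos (inv_pos.2 hρ),
      inv_mul_cancel_left₀ hρ.ne']
  refine ⟨⟨z, hmem⟩, hsmall _ ((ellNorm_mono hp fun i => ?_).trans hx) fun i => ?_⟩
  · calc |x i - ρ⁻¹ * z i| ≤ ρ⁻¹ * |ρ * x i| :=
          (herr i).trans_le (mul_le_mul_of_nonneg_left (hzx i) (inv_pos.2 hρ).le)
      _ = |x i| := by rw [abs_mul, abs_of_pos hρ, inv_mul_cancel_left₀ hρ.ne']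
  · exact (herr i).trans_le (mul_le_of_le_one_right (by positivity) (hz1 i))

end LatticePoints

section UpperBounds

variable {p q : ℝ≥0∞} {n k : ℕ}

theorem entropyNumber_le_mul_volumeRate_of_dyadicRate_le (hp : 0 < p) (hq : 0 < q) (hn : 1 ≤ n)
    (hk : 1 ≤ k) (hsmall : Real.exp 1 * (1 + expMass p) * dyadicRate n k ≤ 1) :
    entropyNumber k (lpId p q n) ≤ Real.exp 1 * (1 + expMass p) * volumeRate p q n k := by
  have hn' : (0 : ℝ) < n := by exact_mod_cast hn
  set K := Real.exp 1 * (1 + expMass p)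
  have hK : 0 < K := mul_pos (Real.exp_pos 1) (add_pos one_pos (expMass_pos p))
  have hT : 0 < dyadicRate n k := dyadicRate_pos n k
  have hr : 0 < K * volumeRate p q n k := by
    rw [volumeRate]
    positivity
  refine entropyNumber_le_of_card_latticeBall_le hp hq
    (ρ := (K * dyadicRate n k)⁻¹ * (n : ℝ) ^ recip p) (by positivity) hr ?_ fun x _ hx => ?_
  · calc (#(latticeBall p n ((K * dyadicRate n k)⁻¹ * (n : ℝ) ^ recip p)) : ℝ)
        ≤ (K * (K * dyadicRate n k)⁻¹) ^ n :=
          card_latticeBall_mul_rpow_le hp ((one_le_inv₀ (by positivity)).2 hsmall)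
      _ = 2 ^ (k - 1) := by
          rw [mul_inv, mul_inv_cancel_left₀ hK.ne', inv_pow, dyadicRate_pow (by lia) hk, inv_inv]
  · have h := ellNorm_le_mul_card_rpow hq (by positivity) (S := univ) (by simp) fun i _ => hx i
    refine h.trans_eq ?_
    rw [card_univ, Fintype.card_fin, volumeRate, mul_inv, inv_inv, ← Real.rpow_neg hn'.le,
      mul_assoc, ← Real.rpow_add hn', neg_add_eq_sub, mul_assoc]

theorem entropyNumber_le_mul_volumeRate_of_ge (hq : 0 < q) (hqp : q ≤ p) (hn : 1 ≤ n)
    (hk : 1 ≤ k) :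
    entropyNumber k (lpId p q n) ≤ Real.exp 1 * (1 + expMass p) * volumeRate p q n k := by
  rcases le_total (Real.exp 1 * (1 + expMass p) * dyadicRate n k) 1 with h | h
  · exact entropyNumber_le_mul_volumeRate_of_dyadicRate_le (hq.trans_le hqp) hq hn hk h
  · rw [volumeRate, ← mul_assoc]
    exact (entropyNumber_lpId_le_card_rpow hq hqp hn).trans
      (le_mul_of_one_le_left (by positivity) h)

theorem one_le_logb_one_add_div (hk : 1 ≤ k) (hkn : k ≤ n) :
    1 ≤ Real.logb 2 (1 + (n : ℝ) / k) := by
  have hk' : (0 : ℝ) < k := by exact_mod_cast hk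
  have hnk : 1 ≤ (n : ℝ) / k := (one_le_div hk').2 (by exact_mod_cast hkn)
  rw [Real.le_logb_iff_rpow_le one_lt_two (by positivity), Real.rpow_one]
  linarith

theorem log_le_logb_two {x : ℝ} (hx : 1 ≤ x) : Real.log x ≤ Real.logb 2 x := by
  rw [Real.logb, le_div_iff₀ (Real.log_pos one_lt_two)]
  exact mul_le_of_le_one_right (Real.log_nonneg hx) (by linarith [Real.log_two_lt_d9])

theorem exp_sparse_count_le_two_pow {G : ℝ} (hG : 0 < G) (hk : 2 ≤ k) (hkn : k ≤ n) :
    Real.exp ((1 + 10 * G + Real.log (1 + (n : ℝ) / k)) *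
        (k / ((20 + 100 * G) * Real.logb 2 (1 + (n : ℝ) / k))) +
      n * (G * Real.exp (1 - (1 + 10 * G + Real.log (1 + (n : ℝ) / k))))) ≤ 2 ^ (k - 1) := by
  have hk2 : (2 : ℝ) ≤ k := by exact_mod_cast hk
  set x : ℝ := 1 + (n : ℝ) / k with hx
  have hx1 : 1 ≤ x := le_add_of_nonneg_right (by positivity)
  have hL : 1 ≤ Real.logb 2 x := one_le_logb_one_add_div (one_le_two.trans hk) hkn
  have hsupport : (1 + 10 * G + Real.log x) * (k / ((20 + 100 * G) * Real.logb 2 x)) ≤ k / 10 := by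
    have hlog := log_le_logb_two hx1
    calc (1 + 10 * G + Real.log x) * (k / ((20 + 100 * G) * Real.logb 2 x))
        ≤ (2 + 10 * G) * Real.logb 2 x * (k / ((20 + 100 * G) * Real.logb 2 x)) := by
          gcongr
          nlinarith
      _ = k / 10 := by field_simp; ring
  have hrest : n * (G * Real.exp (1 - (1 + 10 * G + Real.log x))) ≤ k / 10 := by
    have hGexp : G * Real.exp (-(10 * G)) ≤ 1 / 10 := by
      rw [Real.exp_neg, ← div_eq_mul_inv, div_le_iff₀ (Real.exp_pos _)]
      linarith [Real.add_one_le_exp (10 * G)]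
    have hnx : n / x ≤ (k : ℝ) := by
      rw [div_le_iff₀ (by positivity), hx, mul_add, mul_div_cancel₀ _ (by positivity)]
      linarith
    calc n * (G * Real.exp (1 - (1 + 10 * G + Real.log x)))
        = G * Real.exp (-(10 * G)) * (n / x) := by
          rw [show 1 - (1 + 10 * G + Real.log x) = -(10 * G) - Real.log x by ring, Real.exp_sub,
            Real.exp_log (by positivity)]
          ring
      _ ≤ 1 / 10 * k := by gcongr
      _ = k / 10 := by ring
  have htwo : (2 : ℝ) ^ (k - 1) = Real.exp ((k - 1) * Real.log 2) := by
    rw [← Nat.cast_pred (two_pos.trans_le hk), Real.exp_nat_mul, Real.exp_log two_pos]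
  rw [htwo, Real.exp_le_exp]
  nlinarith [Real.log_two_gt_d9]

theorem entropyNumber_le_mul_sparseRate (hp : 0 < p) (hpq : p ≤ q) (hk : 1 ≤ k) (hkn : k ≤ n) :
    entropyNumber k (lpId p q n) ≤
      (20 + 100 * expMass p) ^ (recip p - recip q) * sparseRate p q n k := by
  have hG := expMass_pos p
  have hk' : (1 : ℝ) ≤ k := by exact_mod_cast hk
  have hL := one_le_logb_one_add_div hk hkn
  have ha : 0 ≤ recip p - recip q := sub_nonneg.2 (recip_le_recip hp hpq)
  rw [sparseRate, ← Real.mul_rpow (by positivity) (by positivity)]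
  set L := Real.logb 2 (1 + (n : ℝ) / k)
  rcases eq_or_ne p ⊤ with rfl | hpt
  · rw [top_le_iff.1 hpq, sub_self, Real.rpow_zero]
    exact entropyNumber_lpId_le_one hp le_rfl
  rcases hk.eq_or_lt' with rfl | hk2
  · refine (entropyNumber_lpId_le_one hp hpq).trans (Real.one_le_rpow ?_ ha)
    rw [Nat.cast_one, div_one]
    nlinarith
  have hp' := ENNReal.toReal_pos hp.ne' hpt
  set m : ℝ := k / ((20 + 100 * expMass p) * L) with hm
  have hlog : 0 ≤ Real.log (1 + (n : ℝ) / k) :=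
    Real.log_nonneg (le_add_of_nonneg_right (by positivity))
  have hcard : (#(latticeBall p n (m ^ recip p)) : ℝ) ≤ 2 ^ (k - 1) :=
    (card_latticeBall_rpow_le_exp hp' (by positivity) (by linarith)).trans
      (exp_sparse_count_le_two_pow hG hk2 hkn)
  refine entropyNumber_le_of_card_latticeBall_le hp (hp.trans_le hpq) (by positivity)
    (by positivity) hcard fun x hx hxm => ?_
  have hm' : (20 + 100 * expMass p) * (L / k) = m⁻¹ := by rw [hm, inv_div, mul_div_assoc]
  have hexp : recip p * (1 - p.toReal * recip q) = recip p - recip q := by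
    rw [recip_eq_inv_toReal p]
    field_simp
  calc ellNorm q x
      ≤ ((m ^ recip p)⁻¹) ^ (1 - p.toReal * recip q) * ellNorm p x ^ (p.toReal * recip q) :=
        ellNorm_le_rpow_mul_rpow hp hpt hpq (by positivity) hxm
    _ ≤ ((m ^ recip p)⁻¹) ^ (1 - p.toReal * recip q) :=
        mul_le_of_le_one_right (by positivity) (Real.rpow_le_one (ellNorm_nonneg hp) hx
          (mul_nonneg hp'.le (recip_nonneg q)))
    _ = ((20 + 100 * expMass p) * (L / k)) ^ (recip p - recip q) := by
        rw [hm', ← Real.inv_rpow (by positivity), ← Real.rpow_mul (by positivity), hexp]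

theorem sparseRate_self (hn : 1 ≤ n) : sparseRate p q n n = (n : ℝ) ^ (recip q - recip p) := by
  have hn' : (n : ℝ) ≠ 0 := by positivity
  rw [sparseRate, div_self hn', one_add_one_eq_two, Real.logb_self_eq_one one_lt_two, one_div,
    Real.inv_rpow (by positivity), ← Real.rpow_neg (by positivity), neg_sub]

theorem entropyNumber_le_mul_volumeRate_of_le (hp : 0 < p) (hpq : p ≤ q) (hn : 1 ≤ n)
    (hnk : n ≤ k) :
    entropyNumber k (lpId p q n) ≤ Real.exp 1 * (1 + expMass p) *
      (20 + 100 * expMass p) ^ (recip p - recip q) * volumeRate p q n k := by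
  have hq := hp.trans_le hpq
  have hG := expMass_pos p
  have hT := dyadicRate_pos n k
  set D := (20 + 100 * expMass p) ^ (recip p - recip q)
  rcases le_total (Real.exp 1 * (1 + expMass p) * dyadicRate n k) 1 with h | h
  · have hD : 1 ≤ D := Real.one_le_rpow (by linarith) (sub_nonneg.2 (recip_le_recip hp hpq))
    refine (entropyNumber_le_mul_volumeRate_of_dyadicRate_le hp hq hn (hn.trans hnk) h).trans ?_
    rw [volumeRate]
    exact mul_le_mul_of_nonneg_right (le_mul_of_one_le_right (by positivity) hD) (by positivity)
  · calc entropyNumber k (lpId p q n)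
        ≤ entropyNumber n (lpId p q n) :=
          entropyNumber_anti (coveringRadii_lpId_nonempty hp hq hn) hnk
      _ ≤ D * (n : ℝ) ^ (recip q - recip p) :=
          (entropyNumber_le_mul_sparseRate hp hpq hn le_rfl).trans_eq (by rw [sparseRate_self hn])
      _ ≤ Real.exp 1 * (1 + expMass p) * dyadicRate n k * (D * (n : ℝ) ^ (recip q - recip p)) :=
          le_mul_of_one_le_left (by positivity) h
      _ = _ := by rw [volumeRate]; ring

end UpperBounds

section Packing

variable {p q : ℝ≥0∞} {n k : ℕ}

theorem le_entropyNumber_of_packing (hp : 0 < p) (hq : 0 < q) (hn : 1 ≤ n) {α : Type*} [Fintype α]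
    {x : α → Fin n → ℝ} {ε V : ℝ} (hx : ∀ a, ellNorm p (x a) ≤ 1) (hV : 0 ≤ V)
    (hclose : ∀ a, (#{b | ellNorm q (x b - x a) < ε} : ℝ) ≤ V)
    (hcard : 2 ^ (k - 1) * V < Fintype.card α) :
    ε / (2 * 2 ^ recip q) ≤ entropyNumber k (lpId p q n) := by
  refine le_entropyNumber_lpId hp hq hn fun r _ y hy => ?_
  by_contra! hr
  choose c hc using fun a => hy _ (hx a)
  obtain ⟨j, hj⟩ : ∃ j, V < (#{a | c a = j} : ℝ) :=
    Fintype.exists_lt_card_fiber_of_nsmul_lt_card c (by simpa using hcard)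
  obtain ⟨a, ha⟩ : ({a | c a = j} : Finset α).Nonempty := by
    rw [← card_pos]
    exact_mod_cast hV.trans_lt hj
  have ha : c a = j := (mem_filter.1 ha).2
  refine absurd (hclose a) (not_le.2 (hj.trans_le ?_))
  refine Nat.cast_le.2 (card_le_card (monotone_filter_right _ fun b _ hb => ?_))
  have hsub : x b - x a = (x b - y j) - (x a - y j) := (sub_sub_sub_cancel_right _ _ _).symm
  calc ellNorm q (x b - x a)
      ≤ 2 * 2 ^ recip q * max (ellNorm q (x b - y j)) (ellNorm q (x a - y j)) := by
        rw [hsub]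
        exact ellNorm_sub_le hq
    _ ≤ 2 * 2 ^ recip q * r := by
        gcongr
        exact max_le (hb ▸ hc b) (ha ▸ hc a)
    _ < ε := by
        rw [mul_comm]
        exact (lt_div_iff₀ (by positivity)).1 hr

theorem inv_le_entropyNumber_of_two_pow_le (hp : 0 < p) (hq : 0 < q) (hk : 1 ≤ k)
    (hkn : 2 ^ k ≤ n) : (2 * 2 ^ recip q)⁻¹ ≤ entropyNumber k (lpId p q n) := by
  rw [← one_div]
  refine le_entropyNumber_of_packing hp hq (Nat.one_le_two_pow.trans hkn)
    (x := fun i => Pi.single i 1) (V := 1) (fun i => ?_) zero_le_one (fun i => ?_) ?_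
  · simpa using ellNorm_le_mul_card_rpow hp zero_le_one (S := {i})
      (fun j hj => Pi.single_eq_of_ne (by simpa using hj) _) (x := Pi.single i 1) (by simp)
  · refine Nat.cast_le_one.2 (card_le_card (t := {i}) fun j hj => ?_)
    by_contra hji
    have hji : j ≠ i := by simpa using hji
    refine absurd (mem_filter.1 hj).2 (not_lt.2 ?_)
    simpa [hji] using mul_card_rpow_le_ellNorm hq zero_le_one (singleton_nonempty j)
      (x := Pi.single j 1 - Pi.single i 1) (by simp [hji])
  · rw [mul_one, Fintype.card_fin]
    exact_mod_cast (Nat.pow_lt_pow_right one_lt_two (Nat.sub_one_lt_of_lt hk)).trans_le hkn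

theorem card_hammingDist_le_half {κ α : Type*} [Fintype κ] [DecidableEq κ] [Fintype α]
    [DecidableEq α] [Nonempty α] (g : κ → α) :
    (#{f : κ → α | 2 * hammingDist f g ≤ Fintype.card κ} : ℝ) ≤
      (2 * √(Fintype.card α)) ^ Fintype.card κ := by
  set s : ℝ := (Fintype.card α : ℝ)
  have hs : 1 ≤ s := Nat.one_le_cast.2 Fintype.card_pos
  have hdist : ∀ f : κ → α, (hammingDist f g : ℝ) = ∑ j, if f j ≠ g j then 1 else 0 := fun f =>
    natCast_card_filter _ _
  have hfiber : ∀ j, ∑ a, Real.exp (-(Real.log s * if a ≠ g j then 1 else 0)) ≤ 2 := fun j => by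
    calc ∑ a, Real.exp (-(Real.log s * if a ≠ g j then 1 else 0))
        ≤ ∑ a, ((if a = g j then 1 else 0) + s⁻¹) := by
          refine sum_le_sum fun a _ => ?_
          by_cases ha : a = g j
          · simp [ha, zero_le_one.trans hs]
          · simp [ha, Real.exp_neg, Real.exp_log (one_pos.trans_le hs)]
      _ = 2 := by
          rw [sum_add_distrib, sum_ite_eq' univ (g j), if_pos (mem_univ _), sum_const, card_univ,
            nsmul_eq_mul, mul_inv_cancel₀ (by positivity), one_add_one_eq_two]
  have hexp : Real.exp (Real.log s * (Fintype.card κ / 2)) = √s ^ Fintype.card κ := by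
    rw [mul_div_left_comm, ← Real.log_sqrt (by positivity), Real.exp_nat_mul,
      Real.exp_log (by positivity)]
  have hsub : ({f : κ → α | 2 * hammingDist f g ≤ Fintype.card κ} : Finset (κ → α)) ⊆
      {f ∈ Fintype.piFinset fun _ : κ => (univ : Finset α) |
        ∑ j, (if f j ≠ g j then (1 : ℝ) else 0) ≤ Fintype.card κ / 2} := fun f hf => by
    have hf : 2 * (hammingDist f g : ℝ) ≤ Fintype.card κ := by exact_mod_cast (mem_filter.1 hf).2
    refine mem_filter.2 ⟨by simp, ?_⟩
    rw [← hdist]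
    linarith
  calc (#{f : κ → α | 2 * hammingDist f g ≤ Fintype.card κ} : ℝ)
      ≤ Real.exp (Real.log s * (Fintype.card κ / 2)) *
          ∏ j, ∑ a, Real.exp (-(Real.log s * if a ≠ g j then 1 else 0)) :=
        (Nat.cast_le.2 (card_le_card hsub)).trans
          (card_filter_sum_le_exp (κ := fun _ => α) (fun _ => univ)
            (fun j a => if a ≠ g j then (1 : ℝ) else 0) (Real.log_nonneg hs))
    _ ≤ √s ^ Fintype.card κ * ∏ _j : κ, 2 := by
        rw [hexp]
        gcongr with j
        exact hfiber j
    _ = (2 * √s) ^ Fintype.card κ := by rw [prod_const, card_univ, mul_pow, mul_comm]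

/-- The vector with entry `v` at one point `e (j, f j)` of every block `e '' ({j} × α)` of indices
and entry `0` elsewhere. -/
noncomputable def transversalVector {κ α ι : Type*} (e : κ × α ↪ ι) (v : ℝ) (f : κ → α) : ι → ℝ :=
  Set.indicator (Set.range fun j => e (j, f j)) fun _ => v

section Transversal

variable {κ α ι : Type*} [Fintype κ] [Fintype ι] (e : κ × α ↪ ι) {v : ℝ} (f g : κ → α)

theorem ellNorm_transversalVector_le (hp : 0 < p) (hv : 0 ≤ v) :
    ellNorm p (transversalVector e v f) ≤ v * (Fintype.card κ : ℝ) ^ recip p := by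
  classical
  have hinj : Function.Injective fun j => e (j, f j) := fun i j hij =>
    (Prod.ext_iff.1 (e.injective hij)).1
  rw [← card_univ, ← card_image_of_injective _ hinj]
  refine ellNorm_le_mul_card_rpow hp hv (fun i hi => ?_) fun i hi => ?_
  · exact Set.indicator_of_notMem (by simpa using hi) _
  · rw [transversalVector, Set.indicator_of_mem (by simpa using hi), abs_of_nonneg hv]

theorem mul_hammingDist_rpow_le_ellNorm [DecidableEq α] (hq : 0 < q) (hv : 0 ≤ v) (hfg : f ≠ g) :
    v * (hammingDist f g : ℝ) ^ recip q ≤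
      ellNorm q (transversalVector e v f - transversalVector e v g) := by
  have hinj : Function.Injective fun j => e (j, f j) := fun i j hij =>
    (Prod.ext_iff.1 (e.injective hij)).1
  have hcard : hammingDist f g = #(map ⟨_, hinj⟩ {j | f j ≠ g j}) := (card_map _).symm
  rw [hcard]
  refine mul_card_rpow_le_ellNorm hq hv
    (card_pos.1 (hcard ▸ hammingDist_pos.2 hfg)) fun i hi => ?_
  obtain ⟨j, hj, rfl⟩ := mem_map.1 hi
  have hfj : e (j, f j) ∉ Set.range fun l => e (l, g l) := by
    rintro ⟨l, hl⟩
    obtain ⟨rfl, hlj⟩ := Prod.ext_iff.1 (e.injective hl)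
    exact (mem_filter.1 hj).2 hlj.symm
  rw [Function.Embedding.coeFn_mk, Pi.sub_apply, transversalVector, transversalVector,
    Set.indicator_of_mem (Set.mem_range_self j), Set.indicator_of_notMem hfj, sub_zero,
    abs_of_nonneg hv]

end Transversal

theorem le_entropyNumber_of_blocks (hp : 0 < p) (hq : 0 < q) {m s : ℕ} (hm : 1 ≤ m) (hs : 1 ≤ s)
    (hms : m * s ≤ n) (hcount : (2 : ℝ) ^ (k - 1) * (2 * √s) ^ m < (s : ℝ) ^ m) :
    1 / 2 * (1 / 4) ^ recip q * (m : ℝ) ^ (recip q - recip p) ≤ entropyNumber k (lpId p q n) := by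
  have hm' : (0 : ℝ) < m := by exact_mod_cast hm
  have : Nonempty (Fin s) := ⟨⟨0, hs⟩⟩
  let e : Fin m × Fin s ↪ Fin n := finProdFinEquiv.toEmbedding.trans (Fin.castLEEmb hms)
  set v : ℝ := (m : ℝ) ^ (-recip p) with hv
  have hv0 : 0 ≤ v := by positivity
  have hnorm : ∀ f, ellNorm p (transversalVector e v f) ≤ 1 := fun f =>
    (ellNorm_transversalVector_le e f hp hv0).trans_eq (by
      rw [Fintype.card_fin, hv, ← Real.rpow_add hm', neg_add_cancel, Real.rpow_zero])
  have hsep : ∀ f g, ellNorm q (transversalVector e v f - transversalVector e v g) <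
      v * ((m : ℝ) / 2) ^ recip q → 2 * hammingDist f g ≤ m := fun f g hfg => by
    contrapose! hfg with hfar
    have hne : f ≠ g := hammingDist_pos.1 (by lia)
    have hhalf : (m : ℝ) / 2 ≤ hammingDist f g := by
      rw [div_le_iff₀' two_pos]
      exact_mod_cast hfar.le
    exact (mul_le_mul_of_nonneg_left (Real.rpow_le_rpow (by positivity) hhalf (recip_nonneg q))
      hv0).trans (mul_hammingDist_rpow_le_ellNorm e f g hq hv0 hne)
  calc 1 / 2 * (1 / 4) ^ recip q * (m : ℝ) ^ (recip q - recip p)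
      = v * ((m : ℝ) / 2) ^ recip q / (2 * 2 ^ recip q) := by
        rw [hv, sub_eq_neg_add, Real.rpow_add hm', show (1 / 4 : ℝ) = 1 / 2 / 2 by norm_num,
          Real.div_rpow (by norm_num) two_pos.le, Real.div_rpow one_pos.le two_pos.le,
          Real.div_rpow hm'.le two_pos.le, Real.one_rpow]
        field_simp
    _ ≤ entropyNumber k (lpId p q n) := by
        refine le_entropyNumber_of_packing hp hq ((one_le_mul hm hs).trans hms) hnorm
          (V := (2 * √s) ^ m) (by positivity) (fun g => ?_) (by simpa using hcount)
        refine (Nat.cast_le.2 (card_le_card (monotone_filter_right _ fun f _ => ?_))).trans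
          (by simpa using card_hammingDist_le_half g)
        exact hsep f g

end Packing

section LowerBounds

variable {p q : ℝ≥0∞} {n k : ℕ}

/-- The number `m` of nonzero entries of the sparse vectors packed for `log₂ n ≤ k ≤ n / 256`. It
has the order `k / log₂ (n / k)`, so that the choices of one entry in each of `m` blocks of length
`n / m` outnumber `2^k` Hamming balls of radius `m / 2`. -/
noncomputable def blockCount (n k : ℕ) : ℕ := ⌈8 * k / Real.logb 2 (1 + (n : ℝ) / k)⌉₊

theorem eight_le_logb_one_add_div (hk : 1 ≤ k) (hkn : 256 * k ≤ n) :
    8 ≤ Real.logb 2 (1 + (n : ℝ) / k) := by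
  have hk' : (0 : ℝ) < k := by exact_mod_cast hk
  have ht : 256 ≤ (n : ℝ) / k := (le_div_iff₀ hk').2 (by exact_mod_cast hkn)
  rw [Real.le_logb_iff_rpow_le one_lt_two (by positivity)]
  norm_num
  linarith

theorem logb_one_add_div_le (hk : 1 ≤ k) (hn : 1 ≤ n) (hlog : Real.logb 2 n ≤ k) :
    Real.logb 2 (1 + (n : ℝ) / k) ≤ 2 * k := by
  have hk' : (1 : ℝ) ≤ k := by exact_mod_cast hk
  have hn' : (1 : ℝ) ≤ n := by exact_mod_cast hn
  calc Real.logb 2 (1 + (n : ℝ) / k)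
      ≤ Real.logb 2 (2 * n) := by
        refine Real.logb_le_logb_of_le one_lt_two (by positivity) ?_
        linarith [div_le_self (zero_le_one.trans hn') hk']
    _ = 1 + Real.logb 2 n := by
        rw [Real.logb_mul two_ne_zero (by positivity), Real.logb_self_eq_one one_lt_two]
    _ ≤ 2 * k := by linarith

theorem blockCount_le {n k : ℕ} (hL : 0 < Real.logb 2 (1 + (n : ℝ) / k))
    (hLk : Real.logb 2 (1 + (n : ℝ) / k) ≤ 2 * k) :
    (blockCount n k : ℝ) ≤ 10 * k / Real.logb 2 (1 + (n : ℝ) / k) := by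
  rw [blockCount]
  set L := Real.logb 2 (1 + (n : ℝ) / k)
  calc (⌈8 * k / L⌉₊ : ℝ)
      ≤ 8 * k / L + 1 := (Nat.ceil_lt_add_one (by positivity)).le
    _ ≤ 8 * k / L + 2 * k / L := by gcongr; exact (one_le_div hL).2 hLk
    _ = 10 * k / L := by ring

theorem half_div_le_div_blockCount (hk : 1 ≤ k) (hkn : 256 * k ≤ n) (hlog : Real.logb 2 n ≤ k) :
    (n : ℝ) / k / 2 ≤ (n / blockCount n k : ℕ) := by
  have hk' : (0 : ℝ) < k := by exact_mod_cast hk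
  have ht : 256 ≤ (n : ℝ) / k := (le_div_iff₀ hk').2 (by exact_mod_cast hkn)
  have hL := eight_le_logb_one_add_div hk hkn
  have hm : 0 < blockCount n k := Nat.ceil_pos.2 (by positivity)
  have hm_le : (blockCount n k : ℝ) ≤ 10 * k / 8 :=
    (blockCount_le (by linarith) (logb_one_add_div_le hk (by lia) hlog)).trans (by gcongr)
  have hlt : (n : ℝ) < blockCount n k * ((n / blockCount n k : ℕ) + 1) := by
    exact_mod_cast Nat.lt_mul_div_succ n hm
  set s : ℝ := ((n / blockCount n k : ℕ) : ℝ)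
  have hs : (n : ℝ) / k ≤ 10 / 8 * (s + 1) := by
    rw [div_le_iff₀ hk']
    calc (n : ℝ) ≤ 10 * k / 8 * (s + 1) := hlt.le.trans (by gcongr)
      _ = 10 / 8 * (s + 1) * k := by ring
  linarith

theorem two_mul_rpow_logb_le_sqrt {t s : ℝ} (ht : 256 ≤ t) (hs : t / 2 ≤ s) :
    2 * (2 : ℝ) ^ (Real.logb 2 (1 + t) / 8) ≤ √s := by
  refine Real.le_sqrt_of_sq_le ?_
  have h1t : 0 < 1 + t := by linarith
  have hroot : (2 : ℝ) ^ (Real.logb 2 (1 + t) / 8) = (1 + t) ^ (1 / 8 : ℝ) := by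
    rw [div_eq_mul_one_div, Real.rpow_mul two_pos.le, Real.rpow_logb two_pos (by simp) h1t]
  set w : ℝ := (1 + t) ^ (1 / 8 : ℝ) with hw
  have hw8 : w ^ 8 = 1 + t := by
    rw [hw, ← Real.rpow_mul_natCast h1t.le]
    norm_num
  have hw2 : 2 ≤ w := by
    rw [← pow_le_pow_iff_left₀ two_pos.le (by positivity) (by simp : 8 ≠ 0), hw8]
    linarith
  have hw6 : (2 : ℝ) ^ 6 ≤ w ^ 6 := by gcongr
  rw [hroot]
  nlinarith

theorem two_pow_mul_lt_pow_blockCount (hk : 1 ≤ k) (hkn : 256 * k ≤ n)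
    (hlog : Real.logb 2 n ≤ k) :
    (2 : ℝ) ^ (k - 1) * (2 * √(n / blockCount n k : ℕ)) ^ blockCount n k <
      ((n / blockCount n k : ℕ) : ℝ) ^ blockCount n k := by
  have hk' : (0 : ℝ) < k := by exact_mod_cast hk
  have ht : 256 ≤ (n : ℝ) / k := (le_div_iff₀ hk').2 (by exact_mod_cast hkn)
  have hL := eight_le_logb_one_add_div hk hkn
  have hs := half_div_le_div_blockCount hk hkn hlog
  have hsqrt := two_mul_rpow_logb_le_sqrt ht hs
  have hm : 8 * k / Real.logb 2 (1 + (n : ℝ) / k) ≤ blockCount n k := Nat.le_ceil _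
  set s : ℝ := ((n / blockCount n k : ℕ) : ℝ)
  set L := Real.logb 2 (1 + (n : ℝ) / k)
  set m := blockCount n k
  have hs0 : 0 < s := by linarith
  have hkm : (2 : ℝ) ^ k ≤ ((2 : ℝ) ^ (L / 8)) ^ m := by
    rw [← Real.rpow_natCast, ← Real.rpow_mul_natCast two_pos.le]
    refine Real.rpow_le_rpow_of_exponent_le one_le_two ?_
    rw [div_le_iff₀ (by linarith)] at hm
    linarith
  calc (2 : ℝ) ^ (k - 1) * (2 * √s) ^ m
      < 2 ^ k * (2 * √s) ^ m := by
        gcongr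
        · exact one_lt_two
        · exact Nat.sub_one_lt_of_lt hk
    _ ≤ ((2 : ℝ) ^ (L / 8)) ^ m * (2 * √s) ^ m := by gcongr
    _ = (2 * (2 : ℝ) ^ (L / 8) * √s) ^ m := by rw [← mul_pow]; ring
    _ ≤ (√s * √s) ^ m := by gcongr
    _ = s ^ m := by rw [Real.mul_self_sqrt hs0.le]

theorem mul_sparseRate_le_entropyNumber_of_sparse (hp : 0 < p) (hpq : p ≤ q) (hk : 1 ≤ k)
    (hkn : 256 * k ≤ n) (hlog : Real.logb 2 n ≤ k) :
    1 / 2 * (1 / 4) ^ recip q * (1 / 10) ^ (recip p - recip q) * sparseRate p q n k ≤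
      entropyNumber k (lpId p q n) := by
  have : (0 : ℝ) < k := by exact_mod_cast hk
  have ha : 0 ≤ recip p - recip q := sub_nonneg.2 (recip_le_recip hp hpq)
  have hL := eight_le_logb_one_add_div hk hkn
  have hm_le := blockCount_le (by linarith) (logb_one_add_div_le hk (by lia) hlog)
  have hm : 0 < blockCount n k := Nat.ceil_pos.2 (by positivity)
  have hm' : (0 : ℝ) < blockCount n k := by exact_mod_cast hm
  have hn : (0 : ℝ) < n := by exact_mod_cast show 0 < n by lia
  have hs : 1 ≤ n / blockCount n k := by
    exact_mod_cast (by positivity : (0 : ℝ) < n / k / 2).trans_le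
      (half_div_le_div_blockCount hk hkn hlog)
  refine le_trans ?_ (le_entropyNumber_of_blocks hp (hp.trans_le hpq) hm hs
    (Nat.mul_div_le n _) (two_pow_mul_lt_pow_blockCount hk hkn hlog))
  rw [sparseRate, mul_assoc _ ((1 / 10 : ℝ) ^ _), ← Real.mul_rpow (by norm_num) (by positivity),
    ← neg_sub (recip p), Real.rpow_neg hm'.le, ← Real.inv_rpow hm'.le]
  gcongr
  rw [le_inv_comm₀ (by positivity) hm']
  refine hm_le.trans_eq ?_
  field_simp

theorem mul_sparseRate_le_volumeRate (hp : 0 < p) (hpq : p ≤ q) (hk : 1 ≤ k) (hkn : k ≤ n)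
    (hnk : n < 256 * k) :
    1 / 2 * (1 / 2304) ^ (recip p - recip q) * sparseRate p q n k ≤ volumeRate p q n k := by
  have hk' : (0 : ℝ) < k := by exact_mod_cast hk
  have hkn' : (k : ℝ) ≤ n := by exact_mod_cast hkn
  have hnk' : (n : ℝ) < 256 * k := by exact_mod_cast hnk
  have hn' : (0 : ℝ) < n := hk'.trans_le hkn'
  have hL0 := one_le_logb_one_add_div hk hkn
  have hL : Real.logb 2 (1 + (n : ℝ) / k) ≤ 9 := by
    rw [Real.logb_le_iff_le_rpow one_lt_two (by positivity)]
    have : (n : ℝ) / k < 256 := (div_lt_iff₀ hk').2 hnk'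
    norm_num
    linarith
  have hdyadic : 1 / 2 ≤ dyadicRate n k := by
    rw [dyadicRate, one_div, ← Real.rpow_neg_one]
    refine Real.rpow_le_rpow_of_exponent_le one_le_two (neg_le_neg ?_)
    rw [div_le_one hn']
    linarith
  have hbase : 1 / 2304 * (Real.logb 2 (1 + (n : ℝ) / k) / k) ≤ (n : ℝ)⁻¹ := by
    rw [← one_div, div_mul_div_comm, div_le_div_iff₀ (by positivity) hn']
    nlinarith
  rw [sparseRate, volumeRate, mul_assoc, ← Real.mul_rpow (by norm_num) (by positivity),
    ← neg_sub (recip p), Real.rpow_neg hn'.le, ← Real.inv_rpow hn'.le]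
  gcongr
  exact sub_nonneg.2 (recip_le_recip hp hpq)

theorem exists_mul_sparseRate_le_entropyNumber (hp : 0 < p) (hpq : p ≤ q) :
    ∃ c : ℝ, 0 < c ∧ ∀ n k : ℕ, 1 ≤ k → Real.logb 2 n ≤ k → k ≤ n →
      c * sparseRate p q n k ≤ entropyNumber k (lpId p q n) := by
  have hq := hp.trans_le hpq
  have hG := expMass_pos q
  set c₁ : ℝ := 1 / 2 * (1 / 4) ^ recip q * (1 / 10) ^ (recip p - recip q)
  set c₂ : ℝ := (Real.exp 1 * expMass q)⁻¹
  set c₃ : ℝ := 1 / 2 * (1 / 2304) ^ (recip p - recip q)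
  refine ⟨min c₁ (c₂ * c₃), by positivity, fun n k hk hlog hkn => ?_⟩
  have hrate : 0 ≤ sparseRate p q n k :=
    Real.rpow_nonneg (div_nonneg (zero_le_one.trans (one_le_logb_one_add_div hk hkn))
      k.cast_nonneg) _
  rcases le_or_gt (256 * k) n with h | h
  · exact (mul_le_mul_of_nonneg_right (min_le_left _ _) hrate).trans
      (mul_sparseRate_le_entropyNumber_of_sparse hp hpq hk h hlog)
  · calc min c₁ (c₂ * c₃) * sparseRate p q n k
        ≤ c₂ * (c₃ * sparseRate p q n k) :=
          (mul_le_mul_of_nonneg_right (min_le_right _ _) hrate).trans_eq (mul_assoc _ _ _)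
      _ ≤ c₂ * volumeRate p q n k := by
          gcongr
          exact mul_sparseRate_le_volumeRate hp hpq hk hkn h
      _ ≤ entropyNumber k (lpId p q n) :=
          volumeRate_le_entropyNumber hp hq (hk.trans hkn) hk

end LowerBounds

theorem theorem1p2 (p q : ℝ≥0∞) (hp : 0 < p) (hq : 0 < q) :
    (p ≤ q → ∃ c C : ℝ, 0 < c ∧ 0 < C ∧ ∀ n k : ℕ, 1 ≤ n → 1 ≤ k →
      ((k : ℝ) ≤ Real.logb 2 n →
        c * 1 ≤ entropyNumber k (lpId p q n) ∧ entropyNumber k (lpId p q n) ≤ C * 1) ∧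
      (Real.logb 2 n ≤ (k : ℝ) → k ≤ n →
        c * (Real.logb 2 (1 + (n : ℝ) / (k : ℝ)) / (k : ℝ)) ^ (recip p - recip q)
            ≤ entropyNumber k (lpId p q n) ∧
        entropyNumber k (lpId p q n)
            ≤ C * (Real.logb 2 (1 + (n : ℝ) / (k : ℝ)) / (k : ℝ)) ^ (recip p - recip q)) ∧
      (n ≤ k →
        c * ((2 : ℝ) ^ (-(((k : ℝ) - 1) / (n : ℝ))) * (n : ℝ) ^ (recip q - recip p))
            ≤ entropyNumber k (lpId p q n) ∧
        entropyNumber k (lpId p q n)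
            ≤ C * ((2 : ℝ) ^ (-(((k : ℝ) - 1) / (n : ℝ))) * (n : ℝ) ^ (recip q - recip p)))) ∧
    (q ≤ p → ∃ c C : ℝ, 0 < c ∧ 0 < C ∧ ∀ n k : ℕ, 1 ≤ n → 1 ≤ k →
      c * ((2 : ℝ) ^ (-(((k : ℝ) - 1) / (n : ℝ))) * (n : ℝ) ^ (recip q - recip p))
          ≤ entropyNumber k (lpId p q n) ∧
      entropyNumber k (lpId p q n)
          ≤ C * ((2 : ℝ) ^ (-(((k : ℝ) - 1) / (n : ℝ))) * (n : ℝ) ^ (recip q - recip p))) := by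
  have hlow := fun n k : ℕ => volumeRate_le_entropyNumber (p := p) (n := n) (k := k) hp hq
  have hG := expMass_pos p
  have hGq := expMass_pos q
  refine ⟨fun hpq => ?_, fun hqp => ⟨_, _, by positivity, by positivity, fun n k hn hk =>
    ⟨hlow n k hn hk, entropyNumber_le_mul_volumeRate_of_ge hq hqp hn hk⟩⟩⟩
  obtain ⟨c, hc, hsparse⟩ := exists_mul_sparseRate_le_entropyNumber hp hpq
  set D : ℝ := (20 + 100 * expMass p) ^ (recip p - recip q)
  refine ⟨min (2 * 2 ^ recip q)⁻¹ (min c (Real.exp 1 * expMass q)⁻¹),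
    max 1 (max D (Real.exp 1 * (1 + expMass p) * D)), by positivity, by positivity,
    fun n k hn hk => ⟨fun hkn => ?_, fun hlog hkn => ?_, fun hnk => ?_⟩⟩
  · rw [Real.le_logb_iff_rpow_le one_lt_two (by positivity), Real.rpow_natCast] at hkn
    rw [mul_one, mul_one]
    exact ⟨(min_le_left _ _).trans
      (inv_le_entropyNumber_of_two_pow_le hp hq hk (by exact_mod_cast hkn)),
      (entropyNumber_lpId_le_one hp hpq).trans (le_max_left _ _)⟩
  · have hL := one_le_logb_one_add_div hk hkn
    exact ⟨(hsparse n k hk hlog hkn).trans' (by unfold sparseRate; gcongr; simp),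
      (entropyNumber_le_mul_sparseRate hp hpq hk hkn).trans
        (by unfold sparseRate; gcongr; simp [D])⟩
  · exact ⟨(hlow n k hn hk).trans' (by unfold volumeRate dyadicRate; gcongr; simp),
      (entropyNumber_le_mul_volumeRate_of_le hp hpq hn hnk).trans
        (by unfold volumeRate dyadicRate; gcongr; simp [D])⟩
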